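/- Recall the following notions. A \emph{bounded pseudo-BCK algebra} is a structure $(A,\le,\to,\rightsquigarrow,0,1)$ such that, for all $x,y,z\in A$: $x\to y\le (y\to z)\rightsquigarrow(x\to z)$ and $x\rightsquigarrow y\le (y\rightsquigarrow z)\to(x\rightsquigarrow z)$; $x\le (x\to y)\rightsquigarrow y$ and $x\le (x\rightsquigarrow y)\to y$; $x\le x$; $0\le x\le 1$; $x\le y$ and $y\le x$ imply $x=y$; and $x\le y$ iff $x\to y=1$ iff $x\rightsquigarrow y=1$. A \emph{Bosbach state} on $A$ is a function $s:A\to[0,1]$ with $s(0)=0$, $s(1)=1$, $s(x)+s(x\to y)=s(y)+s(y\to x)$ and $s(x)+s(x\rightsquigarrow y)=s(y)+s(y\rightsquigarrow x)$ for all $x,y\in A$. A \emph{filter} of $A$ is a subset $F\subseteq A$ with $1\in F$ such that $a\in F$ and $a\to b\in F$ imply $b\in F$. It is \emph{proper} if $F\neq A$, \emph{maximal} if it is proper and not properly contained in another proper filter, and \emph{normal} if for all $a,b\in A$: $a\to b\in F$ iff $a\rightsquigarrow b\in F$. For a normal filter $F$, the relation $a\,\Theta_F\, b \iff (a\to b\in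 F$ and $b\to a\in F)$ is a congruence, and $A/F:=A/\Theta_F$ is a bounded pseudo-BCK algebra with the induced operations, where $a/F\le b/F$ iff $a\to b\in F$. A bounded pseudo-BCK algebra $B$ is \emph{term-equivalent to an MV-algebra} if there is an MV-algebra $(B,\oplus,\odot,{}^-,0,1)$ on the same set with the same constants $0,1$ such that, for all $x,y\in B$, $x\to y=x\rightsquigarrow y=x^-\oplus y$ and, conversely, $x^-=x\to 0$, $x\oplus y=(x\to 0)\to y$ and $x\odot y=(x\to(y\to 0))\to 0$. \textbf{Theorem.} Let $A$ be a bounded pseudo-BCK algebra. The following statements are equivalent: (a) $A$ admits a Bosbach state. (b) There exists a normal filter $F\neq A$ of $A$ such that $A/F$ is term-equivalent to an MV-algebra. (c) There exists a normal and maximal filter $F$ of $A$ such that $A/F$ is term-equivalent to an MV-algebra. -/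

import Mathlib

/-- A pseudo-BCK algebra `(A, ≤, →, ⤳, 1)`. The implications `→` and `⤳` are
`imp` and `wimp`, written `⇀` and `⇝` below. -/
class PseudoBCKAlgebra (A : Type*) extends LE A, One A where
  /-- the first implication `→` -/
  imp : A → A → A
  /-- the second implication `⤳` -/
  wimp : A → A → A
  imp_le : ∀ x y z : A, imp x y ≤ wimp (imp y z) (imp x z)
  wimp_le : ∀ x y z : A, wimp x y ≤ imp (wimp y z) (wimp x z)
  le_imp_wimp : ∀ x y : A, x ≤ wimp (imp x y) y
  le_wimp_imp : ∀ x y : A, x ≤ imp (wimp x y) y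
  le_rfl' : ∀ x : A, x ≤ x
  le_one' : ∀ x : A, x ≤ 1
  antisymm' : ∀ x y : A, x ≤ y → y ≤ x → x = y
  le_iff_imp : ∀ x y : A, x ≤ y ↔ imp x y = 1
  le_iff_wimp : ∀ x y : A, x ≤ y ↔ wimp x y = 1

infixr:60 " ⇀ " => PseudoBCKAlgebra.imp
infixr:60 " ⇝ " => PseudoBCKAlgebra.wimp

/-- A bounded pseudo-BCK algebra: a pseudo-BCK algebra with a least element `0`. -/
class BoundedPseudoBCKAlgebra (A : Type*) extends PseudoBCKAlgebra A, Zero A where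
  zero_le' : ∀ x : A, 0 ≤ x

/-- An MV-algebra structure `(B, ⊕, ⊙, ⁻, 0, 1)` on the type `B`. -/
structure MVAlgebra (B : Type*) where
  oplus : B → B → B
  odot : B → B → B
  neg : B → B
  zero : B
  one : B
  oplus_comm : ∀ x y, oplus x y = oplus y x
  oplus_assoc : ∀ x y z, oplus (oplus x y) z = oplus x (oplus y z)
  neg_zero : neg zero = one
  oplus_zero : ∀ x, oplus x zero = x
  oplus_one : ∀ x, oplus x one = one
  neg_neg : ∀ x, neg (neg x) = x
  lukasiewicz : ∀ x y,
    oplus y (neg (oplus y (neg x))) = oplus x (neg (oplus x (neg y)))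
  odot_def : ∀ x y, odot x y = neg (oplus (neg x) (neg y))

/-- A Bosbach state on a bounded pseudo-BCK algebra. -/
structure IsBosbachState {A : Type*} [BoundedPseudoBCKAlgebra A] (s : A → ℝ) : Prop where
  mem_Icc : ∀ x, s x ∈ Set.Icc (0 : ℝ) 1
  imp_eq : ∀ x y : A, s x + s (x ⇀ y) = s y + s (y ⇀ x)
  wimp_eq : ∀ x y : A, s x + s (x ⇝ y) = s y + s (y ⇝ x)
  map_zero : s 0 = 0
  map_one : s 1 = 1

/-- The bounded pseudo-BCK algebra `(B, →, ⤳, 0, 1)` is term-equivalent to an MV-algebra: there is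
an MV-algebra structure on the same set with the same constants `0`, `1`, such that the operations
of each structure are given by the standard terms in the operations of the other:
`x → y = x ⤳ y = x⁻ ⊕ y`, and `x⁻ = x → 0`, `x ⊕ y = (x → 0) → y`,
`x ⊙ y = (x → (y → 0)) → 0`. -/
def IsTermEquivalentToMVAlgebra (B : Type*) [BoundedPseudoBCKAlgebra B] : Prop :=
  ∃ M : MVAlgebra B,
    M.zero = 0 ∧ M.one = 1 ∧
    (∀ x y : B, x ⇀ y = M.oplus (M.neg x) y) ∧
    (∀ x y : B, x ⇝ y = M.oplus (M.neg x) y) ∧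
    (∀ x : B, M.neg x = x ⇀ 0) ∧
    (∀ x y : B, M.oplus x y = (x ⇀ 0) ⇀ y) ∧
    (∀ x y : B, M.odot x y = (x ⇀ (y ⇀ 0)) ⇀ 0)

/-- A filter (deductive system) of a pseudo-BCK algebra. -/
structure PseudoBCKFilter (A : Type*) [PseudoBCKAlgebra A] where
  carrier : Set A
  one_mem : 1 ∈ carrier
  mp : ∀ a b : A, a ∈ carrier → a ⇀ b ∈ carrier → b ∈ carrier

namespace PseudoBCKFilter

section General

variable {A : Type*} [PseudoBCKAlgebra A] (F : PseudoBCKFilter A)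

/-- A filter is proper if it is not the whole algebra. -/
def IsProper : Prop := F.carrier ≠ Set.univ

/-- A filter is maximal if it is proper and not properly contained in another proper filter. -/
def IsMaximal : Prop :=
  F.IsProper ∧ ∀ G : PseudoBCKFilter A, G.IsProper → F.carrier ⊆ G.carrier → G.carrier = F.carrier

/-- A filter `F` is normal if `a → b ∈ F ↔ a ⤳ b ∈ F` for all `a`, `b`. -/
def IsNormal : Prop := ∀ a b : A, a ⇀ b ∈ F.carrier ↔ a ⇝ b ∈ F.carrier

theorem mem_of_le {a b : A} (h : a ≤ b) (ha : a ∈ F.carrier) : b ∈ F.carrier :=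
  F.mp a b ha (by rw [(PseudoBCKAlgebra.le_iff_imp a b).1 h]; exact F.one_mem)

theorem wmp {a b : A} (ha : a ∈ F.carrier) (h : a ⇝ b ∈ F.carrier) : b ∈ F.carrier :=
  F.mp _ _ h (F.mem_of_le (PseudoBCKAlgebra.le_wimp_imp a b) ha)

theorem imp_self_mem (a : A) : a ⇀ a ∈ F.carrier := by
  rw [(PseudoBCKAlgebra.le_iff_imp a a).1 (PseudoBCKAlgebra.le_rfl' a)]; exact F.one_mem

theorem imp_trans_mem {a b c : A} (h₁ : a ⇀ b ∈ F.carrier) (h₂ : b ⇀ c ∈ F.carrier) :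
    a ⇀ c ∈ F.carrier :=
  F.wmp h₂ (F.mem_of_le (PseudoBCKAlgebra.imp_le a b c) h₁)

/-- The relation `Θ_F`: `a` and `b` are related iff `a → b ∈ F` and `b → a ∈ F`. -/
def theta : Setoid A where
  r a b := a ⇀ b ∈ F.carrier ∧ b ⇀ a ∈ F.carrier
  iseqv :=
    { refl := fun a => ⟨F.imp_self_mem a, F.imp_self_mem a⟩
      symm := fun h => ⟨h.2, h.1⟩
      trans := fun h₁ h₂ => ⟨F.imp_trans_mem h₁.1 h₂.1, F.imp_trans_mem h₂.2 h₁.2⟩ }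

/-- The underlying set `A/F = A/Θ_F` of the quotient by a normal filter. -/
def Quotient (_hF : F.IsNormal) : Type _ := _root_.Quotient F.theta

theorem one_imp_mem {c : A} (hc : c ∈ F.carrier) : 1 ⇀ c ∈ F.carrier := by
  have h := PseudoBCKAlgebra.le_wimp_imp c c
  rw [(PseudoBCKAlgebra.le_iff_wimp c c).1 (PseudoBCKAlgebra.le_rfl' c)] at h
  exact F.mem_of_le h hc

theorem imp_one_mem (c : A) : c ⇀ 1 ∈ F.carrier := by
  rw [(PseudoBCKAlgebra.le_iff_imp c 1).1 (PseudoBCKAlgebra.le_one' c)]; exact F.one_mem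

theorem imp_mem_of_le {a b : A} (h : a ≤ b) : a ⇀ b ∈ F.carrier := by
  rw [(PseudoBCKAlgebra.le_iff_imp a b).1 h]; exact F.one_mem

variable {F}

theorem imp_left_mem (hF : F.IsNormal) {a b : A} (z : A) (h : a ⇀ b ∈ F.carrier) :
    (b ⇀ z) ⇀ (a ⇀ z) ∈ F.carrier :=
  (hF _ _).2 (F.mem_of_le (PseudoBCKAlgebra.imp_le a b z) h)

theorem wimp_left_mem (hF : F.IsNormal) {a b : A} (z : A) (h : a ⇀ b ∈ F.carrier) :
    (b ⇝ z) ⇀ (a ⇝ z) ∈ F.carrier :=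
  F.mem_of_le (PseudoBCKAlgebra.wimp_le a b z) ((hF _ _).1 h)

theorem imp_right_mem {x y : A} (z : A) (h : x ⇀ y ∈ F.carrier) :
    (z ⇀ x) ⇀ (z ⇀ y) ∈ F.carrier :=
  F.imp_trans_mem (F.imp_mem_of_le (PseudoBCKAlgebra.imp_le z x y))
    (F.mem_of_le (PseudoBCKAlgebra.le_wimp_imp (x ⇀ y) (z ⇀ y)) h)

theorem wimp_right_mem (hF : F.IsNormal) {x y : A} (z : A) (h : x ⇀ y ∈ F.carrier) :
    (z ⇝ x) ⇀ (z ⇝ y) ∈ F.carrier :=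
  F.imp_trans_mem (F.imp_mem_of_le (PseudoBCKAlgebra.wimp_le z x y))
    ((hF _ _).2 (F.mem_of_le (PseudoBCKAlgebra.le_imp_wimp (x ⇝ y) (z ⇝ y)) ((hF _ _).1 h)))

namespace Quotient

/-- The class `a/F`. -/
def mk (hF : F.IsNormal) (a : A) : F.Quotient hF := _root_.Quotient.mk F.theta a

theorem mk_eq_mk (hF : F.IsNormal) (a b : A) :
    mk hF a = mk hF b ↔ a ⇀ b ∈ F.carrier ∧ b ⇀ a ∈ F.carrier :=
  _root_.Quotient.eq (r := F.theta)

theorem mk_eq_one (hF : F.IsNormal) (c : A) : mk hF c = mk hF 1 ↔ c ∈ F.carrier := by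
  rw [mk_eq_mk]
  exact ⟨fun h => F.mp _ _ F.one_mem h.2, fun h => ⟨F.imp_one_mem c, F.one_imp_mem h⟩⟩

theorem ind {hF : F.IsNormal} {p : F.Quotient hF → Prop} (h : ∀ a, p (mk hF a)) (x) : p x :=
  _root_.Quotient.ind h x

/-- `a/F → b/F = (a → b)/F`. -/
def imp (hF : F.IsNormal) : F.Quotient hF → F.Quotient hF → F.Quotient hF :=
  _root_.Quotient.map₂ (fun a b => a ⇀ b) (fun _ _ h₁ _ _ h₂ =>
    ⟨F.imp_trans_mem (imp_left_mem hF _ h₁.2) (imp_right_mem _ h₂.1),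
      F.imp_trans_mem (imp_left_mem hF _ h₁.1) (imp_right_mem _ h₂.2)⟩)

/-- `a/F ⤳ b/F = (a ⤳ b)/F`. -/
def wimp (hF : F.IsNormal) : F.Quotient hF → F.Quotient hF → F.Quotient hF :=
  _root_.Quotient.map₂ (fun a b => a ⇝ b) (fun _ _ h₁ _ _ h₂ =>
    ⟨F.imp_trans_mem (wimp_left_mem hF _ h₁.2) (wimp_right_mem hF _ h₂.1),
      F.imp_trans_mem (wimp_left_mem hF _ h₁.1) (wimp_right_mem hF _ h₂.2)⟩)

/-- The quotient `A/F` is a pseudo-BCK algebra, with the operations induced from `A` and with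
`a/F ≤ b/F` iff `a/F → b/F = 1/F`, i.e. iff `a → b ∈ F`. -/
instance instPseudoBCKAlgebra (hF : F.IsNormal) : PseudoBCKAlgebra (F.Quotient hF) where
  le x y := imp hF x y = mk hF 1
  one := mk hF 1
  imp := imp hF
  wimp := wimp hF
  imp_le := ind fun x => ind fun y => ind fun z => (mk_eq_one hF _).2
    (F.imp_mem_of_le (PseudoBCKAlgebra.imp_le x y z))
  wimp_le := ind fun x => ind fun y => ind fun z => (mk_eq_one hF _).2
    (F.imp_mem_of_le (PseudoBCKAlgebra.wimp_le x y z))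
  le_imp_wimp := ind fun x => ind fun y => (mk_eq_one hF _).2
    (F.imp_mem_of_le (PseudoBCKAlgebra.le_imp_wimp x y))
  le_wimp_imp := ind fun x => ind fun y => (mk_eq_one hF _).2
    (F.imp_mem_of_le (PseudoBCKAlgebra.le_wimp_imp x y))
  le_rfl' := ind fun x => (mk_eq_one hF _).2 (F.imp_self_mem x)
  le_one' := ind fun x => (mk_eq_one hF _).2 (F.imp_one_mem x)
  antisymm' := ind fun x => ind fun y => fun h₁ h₂ =>
    (mk_eq_mk hF x y).2 ⟨(mk_eq_one hF _).1 h₁, (mk_eq_one hF _).1 h₂⟩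
  le_iff_imp _ _ := Iff.rfl
  le_iff_wimp := ind fun x => ind fun y =>
    (mk_eq_one hF (x ⇀ y)).trans ((hF x y).trans (mk_eq_one hF (x ⇝ y)).symm)

end Quotient

end General

section Bounded

variable {A : Type*} [BoundedPseudoBCKAlgebra A] {F : PseudoBCKFilter A}

/-- The quotient of a bounded pseudo-BCK algebra is bounded, with zero `0/F`. -/
instance Quotient.instBoundedPseudoBCKAlgebra (hF : F.IsNormal) :
    BoundedPseudoBCKAlgebra (F.Quotient hF) where
  zero := Quotient.mk hF 0
  zero_le' := Quotient.ind fun x => (Quotient.mk_eq_one hF _).2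
    (F.imp_mem_of_le (BoundedPseudoBCKAlgebra.zero_le' x))

end Bounded

end PseudoBCKFilter

/-! From a state to a quotient: the Bosbach states form a compact set, so if there is one there is
an extreme one `s` (Krein–Milman). Modulo its kernel `s` is faithful and still extreme. Faithfulness
gives the relative double negation laws `IsPseudoMV`, hence a symmetric join `(x ⇀ y) ⇝ y`.
Extremality gives a chain: if `c = x ⇀ y` is not `1`, the limit `σ z` of `s (c ⇀ ⋯ ⇀ c ⇀ z)` is
additive on comparable pairs. Either `σ 0 < 1` and `σ` splits `s` into two states, one of them `1`
at `c`, which extremality forbids; or `σ` is constantly `1`, and prelinearity yields `y ≤ x`. On a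
chain a faithful state is injective, so the equality of `s (x ⇀ y)` and `s (x ⇝ y)` forces `⇀ = ⇝`,
and the quotient is MV.

From a proper to a maximal filter: Zorn; the MV conditions say that certain elements lie in the
filter, so they pass to larger filters.

From a maximal filter to a state: the quotient is simple. Let `impCount x y` be the number of
applications of `x ⇀ ·` that take `y` to `1`. Then `1 - impCount x y / impCount x 0` is additive up
to a small error when `impCount x 0` is large, and exactly when `x` is a coatom. An ultrafilter
limit is a state, which is pulled back to `A`. -/

namespace PseudoBCKAlgebra

/-! ### Arithmetic of the two implications and their iterates -/

section Basic

variable {A : Type*} [PseudoBCKAlgebra A] {x y z : A}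

theorem one_le_iff : 1 ≤ x ↔ x = 1 :=
  ⟨fun h => antisymm' _ _ (le_one' x) h, fun h => h ▸ le_rfl' _⟩

theorem imp_self (x : A) : x ⇀ x = 1 := (le_iff_imp x x).1 (le_rfl' x)

theorem wimp_self (x : A) : x ⇝ x = 1 := (le_iff_wimp x x).1 (le_rfl' x)

theorem one_imp (x : A) : 1 ⇀ x = x := by
  refine antisymm' _ _ ((le_iff_wimp _ _).2 (one_le_iff.1 (le_imp_wimp 1 x))) ?_
  simpa [wimp_self] using le_wimp_imp x x

theorem one_wimp (x : A) : 1 ⇝ x = x := by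
  refine antisymm' _ _ ((le_iff_imp _ _).2 (one_le_iff.1 (le_wimp_imp 1 x))) ?_
  simpa [imp_self] using le_imp_wimp x x

instance : PartialOrder A where
  le_refl := le_rfl'
  le_trans x y z hxy hyz := by
    have h := imp_le x y z
    rw [(le_iff_imp _ _).1 hxy, (le_iff_imp _ _).1 hyz, one_wimp, one_le_iff] at h
    exact (le_iff_imp _ _).2 h
  le_antisymm := antisymm'

theorem imp_eq_one : x ⇀ y = 1 ↔ x ≤ y := (le_iff_imp x y).symm

theorem wimp_eq_one : x ⇝ y = 1 ↔ x ≤ y := (le_iff_wimp x y).symm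

theorem imp_anti (h : x ≤ y) (z : A) : y ⇀ z ≤ x ⇀ z := by
  have := imp_le x y z
  rwa [imp_eq_one.2 h, one_le_iff, wimp_eq_one] at this

theorem wimp_anti (h : x ≤ y) (z : A) : y ⇝ z ≤ x ⇝ z := by
  have := wimp_le x y z
  rwa [wimp_eq_one.2 h, one_le_iff, imp_eq_one] at this

theorem imp_mono (z : A) : Monotone (fun x : A => z ⇀ x) := fun x y h => by
  have := imp_le z x y
  rwa [imp_eq_one.2 h, one_wimp] at this

theorem wimp_mono (z : A) : Monotone (fun x : A => z ⇝ x) := fun x y h => by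
  have := wimp_le z x y
  rwa [wimp_eq_one.2 h, one_imp] at this

theorem le_imp_comm : x ≤ y ⇀ z ↔ y ≤ x ⇝ z :=
  ⟨fun h => (le_imp_wimp y z).trans (wimp_anti h z),
    fun h => (le_wimp_imp x z).trans (imp_anti h z)⟩

theorem imp_wimp_comm (x y z : A) : x ⇀ (y ⇝ z) = y ⇝ (x ⇀ z) :=
  le_antisymm ((imp_le x (y ⇝ z) z).trans (wimp_anti (le_wimp_imp y z) _))
    ((wimp_le y (x ⇀ z) z).trans (imp_anti (le_imp_wimp x z) _))

theorem imp_le_imp_imp (x y z : A) : x ⇀ y ≤ (z ⇀ x) ⇀ (z ⇀ y) :=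
  le_imp_comm.2 (imp_le z x y)

theorem wimp_le_wimp_wimp (x y z : A) : x ⇝ y ≤ (z ⇝ x) ⇝ (z ⇝ y) :=
  le_imp_comm.1 (wimp_le z x y)

theorem le_imp (x y : A) : y ≤ x ⇀ y := by
  simpa [one_imp] using imp_anti (le_one' x) y

theorem le_wimp (x y : A) : y ≤ x ⇝ y := by
  simpa [one_wimp] using wimp_anti (le_one' x) y

theorem imp_wimp_imp (x y : A) : ((x ⇀ y) ⇝ y) ⇀ y = x ⇀ y :=
  le_antisymm (imp_anti (le_imp_wimp x y) y) (le_wimp_imp _ y)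

theorem wimp_imp_wimp (x y : A) : ((x ⇝ y) ⇀ y) ⇝ y = x ⇝ y :=
  le_antisymm (wimp_anti (le_wimp_imp x y) y) (le_imp_wimp _ y)

/-- The exchange law, iterated: powers of `c ⇀ ·` move past `z ⇝ ·`. The limit along iterates and
the counting argument both rest on this. -/
theorem imp_iterate_wimp (c z y : A) (n : ℕ) :
    (c ⇀ ·)^[n] (z ⇝ y) = z ⇝ (c ⇀ ·)^[n] y := by
  induction n with
  | zero => rfl
  | succ n ih => rw [Function.iterate_succ_apply', ih, Function.iterate_succ_apply', imp_wimp_comm]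

theorem wimp_iterate_imp (c z y : A) (n : ℕ) :
    (c ⇝ ·)^[n] (z ⇀ y) = z ⇀ (c ⇝ ·)^[n] y := by
  induction n with
  | zero => rfl
  | succ n ih => rw [Function.iterate_succ_apply', ih, Function.iterate_succ_apply', imp_wimp_comm]

theorem imp_le_iterate_imp (c z y : A) (n : ℕ) :
    z ⇀ y ≤ (c ⇀ ·)^[n] z ⇀ (c ⇀ ·)^[n] y := by
  induction n with
  | zero => exact le_rfl
  | succ n ih =>
    rw [Function.iterate_succ_apply', Function.iterate_succ_apply']
    exact ih.trans (imp_le_imp_imp _ _ _)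

theorem wimp_le_iterate_wimp (c z y : A) (n : ℕ) :
    z ⇝ y ≤ (c ⇝ ·)^[n] z ⇝ (c ⇝ ·)^[n] y := by
  induction n with
  | zero => exact le_rfl
  | succ n ih =>
    rw [Function.iterate_succ_apply', Function.iterate_succ_apply']
    exact ih.trans (wimp_le_wimp_wimp _ _ _)

theorem imp_iterate_monotone_nat (c z : A) : Monotone fun n => (c ⇀ ·)^[n] z :=
  monotone_nat_of_le_succ fun n => by
    rw [Function.iterate_succ_apply']; exact le_imp _ _

theorem imp_iterate_anti {c d : A} (h : c ≤ d) (z : A) (n : ℕ) :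
    (d ⇀ ·)^[n] z ≤ (c ⇀ ·)^[n] z := by
  induction n with
  | zero => exact le_rfl
  | succ n ih =>
    rw [Function.iterate_succ_apply', Function.iterate_succ_apply']
    exact (imp_mono d ih).trans (imp_anti h _)

end Basic

end PseudoBCKAlgebra

open PseudoBCKAlgebra BoundedPseudoBCKAlgebra

/-- The relative double negation laws that hold in a pseudo-MV-algebra. -/
structure IsPseudoMV (B : Type*) [PseudoBCKAlgebra B] : Prop where
  imp_wimp : ∀ {y v : B}, y ≤ v → (v ⇀ y) ⇝ y = v
  wimp_imp : ∀ {y v : B}, y ≤ v → (v ⇝ y) ⇀ y = v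

/-! ### Joins, divisibility and prelinearity -/

namespace IsPseudoMV

section General

variable {B : Type*} [PseudoBCKAlgebra B] (h : IsPseudoMV B)

include h

theorem join_le {x y v : B} (hx : x ≤ v) (hy : y ≤ v) : (x ⇀ y) ⇝ y ≤ v :=
  (wimp_anti (imp_anti hx y) y).trans (h.imp_wimp hy).le

theorem join_le' {x y v : B} (hx : x ≤ v) (hy : y ≤ v) : (x ⇝ y) ⇀ y ≤ v :=
  (imp_anti (wimp_anti hx y) y).trans (h.wimp_imp hy).le

theorem join_comm (x y : B) : (x ⇀ y) ⇝ y = (y ⇀ x) ⇝ x :=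
  le_antisymm (h.join_le (le_wimp _ _) (le_imp_wimp _ _))
    (h.join_le (le_wimp _ _) (le_imp_wimp _ _))

theorem join_comm' (x y : B) : (x ⇝ y) ⇀ y = (y ⇝ x) ⇀ x :=
  le_antisymm (h.join_le' (le_imp _ _) (le_wimp_imp _ _))
    (h.join_le' (le_imp _ _) (le_wimp_imp _ _))

/-- A function that is additive on comparable pairs satisfies the Bosbach identities. -/
theorem bosbach_of_additive {f : B → ℝ}
    (h₁ : ∀ y z, y ≤ z → f (z ⇀ y) = 1 + f y - f z)
    (h₂ : ∀ y z, y ≤ z → f (z ⇝ y) = 1 + f y - f z) (x y : B) :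
    f x + f (x ⇀ y) = f y + f (y ⇀ x) ∧ f x + f (x ⇝ y) = f y + f (y ⇝ x) := by
  constructor
  -- With `j` the join, `x ⇀ y = j ⇀ y`, so both sides equal `1 + f x + f y - f j`.
  · rw [← imp_wimp_imp x y, ← imp_wimp_imp y x, h₁ _ _ (le_wimp _ _), h₁ _ _ (le_wimp _ _),
      h.join_comm x y]
    ring
  · rw [← wimp_imp_wimp x y, ← wimp_imp_wimp y x, h₂ _ _ (le_imp _ _), h₂ _ _ (le_imp _ _),
      h.join_comm' x y]
    ring

end General

variable {B : Type*} [BoundedPseudoBCKAlgebra B] (h : IsPseudoMV B)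

include h

theorem imp_eq_neg_wimp_neg (x y : B) : x ⇀ y = (y ⇀ 0) ⇝ (x ⇀ 0) := by
  rw [← imp_wimp_comm, h.imp_wimp (zero_le' y)]

/-- Divisibility without a product: in residuated terms, `z` is the product of `x` and `x ⇀ z`.
Contraposition reduces it to double negation. -/
theorem imp_imp_imp {x z : B} (hzx : z ≤ x) (u : B) : (x ⇀ z) ⇀ (x ⇀ u) = z ⇀ u := by
  rw [h.imp_eq_neg_wimp_neg x z, h.imp_eq_neg_wimp_neg x u, imp_wimp_comm,
    h.wimp_imp (imp_anti hzx 0), ← h.imp_eq_neg_wimp_neg]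

/-- The join `q` of `x ⇀ y` and `y ⇀ x` is `1`. With `w` the join of `x` and `y`, divisibility
bounds `q ⇀ (w ⇀ 0)` by the negations of both `x` and `y`, hence by `w ⇀ 0`; double negation
relative to `w ⇀ 0` then gives `q = 1`. -/
theorem prelinear (x y : B) : (x ⇀ y) ⇀ (y ⇀ x) = y ⇀ x := by
  set w := (x ⇀ y) ⇝ y with hw
  have hw' : w = (y ⇀ x) ⇝ x := h.join_comm x y
  have hyw : y ≤ w := le_wimp _ _
  have hxw : x ≤ w := le_imp_wimp _ _
  have hc : x ⇀ y = w ⇀ y := (imp_wimp_imp x y).symm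
  have hd : y ⇀ x = w ⇀ x := by rw [hw']; exact (imp_wimp_imp y x).symm
  rw [hc, hd]
  set q := ((w ⇀ y) ⇀ (w ⇀ x)) ⇝ (w ⇀ x) with hq
  have hcq : w ⇀ y ≤ q := le_imp_wimp _ _
  have hdq : w ⇀ x ≤ q := le_wimp _ _
  have hr₁ : q ⇀ (w ⇀ 0) ≤ y ⇀ 0 := (imp_anti hcq _).trans (h.imp_imp_imp hyw 0).le
  have hr₂ : q ⇀ (w ⇀ 0) ≤ x ⇀ 0 := (imp_anti hdq _).trans (h.imp_imp_imp hxw 0).le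
  have hr : q ⇀ (w ⇀ 0) = w ⇀ 0 :=
    le_antisymm (le_imp_comm.2 (h.join_le (le_imp_comm.1 hr₂) (le_imp_comm.1 hr₁))) (le_imp _ _)
  have hnq : w ⇀ 0 ≤ q := (imp_mono w (zero_le' y)).trans hcq
  have hq1 : q = 1 := by
    rw [← h.imp_wimp hnq, hr, wimp_self]
  exact le_antisymm (wimp_eq_one.1 hq1) (le_imp _ _)

end IsPseudoMV

/-! ### Bosbach states, their limits along iterates, and kernels -/

namespace IsBosbachState

variable {A : Type*} [BoundedPseudoBCKAlgebra A] {s : A → ℝ} (hs : IsBosbachState s)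

include hs

theorem le_one (x : A) : s x ≤ 1 := (hs.mem_Icc x).2

theorem imp_of_le {y z : A} (h : y ≤ z) : s (z ⇀ y) = 1 + s y - s z := by
  have := hs.imp_eq y z
  rw [imp_eq_one.2 h, hs.map_one] at this
  linarith

theorem wimp_of_le {y z : A} (h : y ≤ z) : s (z ⇝ y) = 1 + s y - s z := by
  have := hs.wimp_eq y z
  rw [wimp_eq_one.2 h, hs.map_one] at this
  linarith

theorem mono : Monotone s := fun x y h => by
  have := hs.imp_of_le h
  linarith [hs.le_one (y ⇀ x)]

theorem imp_le (x y : A) : s (x ⇀ y) ≤ 1 + s y - s x := by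
  linarith [hs.imp_eq x y, hs.le_one (y ⇀ x)]

theorem wimp_le (x y : A) : s (x ⇝ y) ≤ 1 + s y - s x := by
  linarith [hs.wimp_eq x y, hs.le_one (y ⇝ x)]

/-- For comparable arguments both values are given by the same formula. In general, replace `x` by
the upper bound `(x ⇀ y) ⇝ y`, which leaves `x ⇀ y` unchanged and can only decrease `x ⇝ y`; then
exchange the roles. -/
theorem imp_eq_wimp (x y : A) : s (x ⇀ y) = s (x ⇝ y) := by
  apply le_antisymm
  · have h₁ := hs.wimp_of_le (le_wimp (x ⇀ y) y)
    have h₂ := hs.imp_of_le (le_wimp (x ⇀ y) y)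
    rw [imp_wimp_imp] at h₂
    rw [h₂, ← h₁]
    exact hs.mono (wimp_anti (le_imp_wimp x y) y)
  · have h₁ := hs.imp_of_le (le_imp (x ⇝ y) y)
    have h₂ := hs.wimp_of_le (le_imp (x ⇝ y) y)
    rw [wimp_imp_wimp] at h₂
    rw [h₂, ← h₁]
    exact hs.mono (imp_anti (le_wimp_imp x y) y)

theorem imp_iterate_eq_wimp_iterate (c : A) (n : ℕ) (z : A) :
    s ((c ⇀ ·)^[n] z) = s ((c ⇝ ·)^[n] z) := by
  induction n generalizing z with
  | zero => rfl
  | succ n ih =>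
    rw [Function.iterate_succ_apply, ih, wimp_iterate_imp, hs.imp_eq_wimp,
      Function.iterate_succ_apply']

theorem imp_iterate_wimp_iterate (c : A) (n k : ℕ) (z : A) :
    s ((c ⇀ ·)^[n] ((c ⇝ ·)^[k] z)) = s ((c ⇀ ·)^[n + k] z) := by
  rw [hs.imp_iterate_eq_wimp_iterate, hs.imp_iterate_eq_wimp_iterate, Function.iterate_add_apply]

theorem wimp_iterate_le (c y z : A) (n : ℕ) (h : y ≤ z) :
    1 + s ((c ⇀ ·)^[n] y) - s ((c ⇀ ·)^[n] z) ≤ s ((c ⇀ ·)^[n] (z ⇝ y)) := by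
  rw [imp_iterate_wimp, ← hs.wimp_of_le ((imp_mono c).iterate n h)]
  exact hs.mono (wimp_anti (imp_iterate_monotone_nat c z (Nat.zero_le n)) _)

theorem imp_iterate_le (c y z : A) (n : ℕ) (h : y ≤ z) :
    1 + s ((c ⇀ ·)^[n] y) - s ((c ⇀ ·)^[n] z) ≤ s ((c ⇀ ·)^[n] (z ⇀ y)) := by
  simp only [hs.imp_iterate_eq_wimp_iterate]
  rw [wimp_iterate_imp, ← hs.imp_of_le ((wimp_mono c).iterate n h)]
  refine hs.mono (imp_anti ?_ _)
  exact (Function.id_le_iterate_of_id_le (fun z => le_wimp c z) n) z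

theorem le_wimp_iterate (c y z : A) (n : ℕ) :
    s ((c ⇀ ·)^[n] (z ⇝ y)) ≤ 1 + s ((c ⇀ ·)^[n + n] y) - s ((c ⇀ ·)^[n] z) := by
  have h := hs.wimp_le ((c ⇝ ·)^[n] z) ((c ⇝ ·)^[n] ((c ⇀ ·)^[n] y))
  rw [← hs.imp_iterate_eq_wimp_iterate, ← hs.imp_iterate_eq_wimp_iterate,
    ← Function.iterate_add_apply] at h
  refine le_trans (hs.mono ?_) h
  rw [imp_iterate_wimp]
  exact wimp_le_iterate_wimp _ _ _ _

theorem le_imp_iterate (c y z : A) (n : ℕ) :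
    s ((c ⇀ ·)^[n] (z ⇀ y)) ≤ 1 + s ((c ⇀ ·)^[n + n] y) - s ((c ⇀ ·)^[n] z) := by
  have h := hs.imp_le ((c ⇀ ·)^[n] z) ((c ⇀ ·)^[n] ((c ⇝ ·)^[n] y))
  rw [hs.imp_iterate_wimp_iterate] at h
  refine le_trans ?_ h
  rw [hs.imp_iterate_eq_wimp_iterate, wimp_iterate_imp]
  exact hs.mono (imp_le_iterate_imp _ _ _ _)

/-- The values `s ((c ⇀ ·)^[n] z)` increase with `n`; `σ` is their limit. Additivity is a squeeze:
the lower bound uses `n` iterates on `y`, the upper one `n + n`, and both converge to the same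
limit. -/
theorem exists_iterate_limit (c : A) : ∃ σ : A → ℝ, (∀ z, s z ≤ σ z) ∧ (∀ z, σ z ≤ 1) ∧
    Monotone σ ∧ σ c = 1 ∧ (∀ z, c ⇀ z = z → σ z = s z) ∧
    (∀ y z, y ≤ z → σ (z ⇀ y) = 1 + σ y - σ z) ∧
    (∀ y z, y ≤ z → σ (z ⇝ y) = 1 + σ y - σ z) := by
  have hbdd : ∀ z, BddAbove (Set.range fun n => s ((c ⇀ ·)^[n] z)) := fun z =>
    ⟨1, by rintro _ ⟨n, rfl⟩; exact hs.le_one _⟩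
  have hlim : ∀ z, Filter.Tendsto (fun n => s ((c ⇀ ·)^[n] z)) Filter.atTop
      (nhds (⨆ n, s ((c ⇀ ·)^[n] z))) := fun z =>
    tendsto_atTop_ciSup (fun m n h => hs.mono (imp_iterate_monotone_nat c z h)) (hbdd z)
  have h2 : Filter.Tendsto (fun n : ℕ => n + n) Filter.atTop Filter.atTop :=
    Filter.tendsto_atTop_mono (fun n => Nat.le_add_left n n) Filter.tendsto_id
  have hle : ∀ z, (⨆ n, s ((c ⇀ ·)^[n] z)) ≤ 1 := fun z => ciSup_le fun n => hs.le_one _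
  refine ⟨fun z => ⨆ n, s ((c ⇀ ·)^[n] z), fun z => le_ciSup (hbdd z) 0, hle,
    fun y z h => ciSup_mono (hbdd z) fun n => hs.mono ((imp_mono c).iterate n h), ?_, ?_, ?_, ?_⟩
  · refine le_antisymm (hle c) (le_ciSup_of_le (hbdd c) 1 ?_)
    simp [PseudoBCKAlgebra.imp_self, hs.map_one]
  · intro z hz
    have : ∀ n, (c ⇀ ·)^[n] z = z := fun n => Function.iterate_fixed hz n
    simp [this]
  · intro y z h
    exact le_antisymm
      (le_of_tendsto_of_tendsto' (hlim _) (((hlim y).comp h2).const_add 1 |>.sub (hlim z))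
        fun n => hs.le_imp_iterate c y z n)
      (le_of_tendsto_of_tendsto' (((hlim y).const_add 1).sub (hlim z)) (hlim _)
        fun n => hs.imp_iterate_le c y z n h)
  · intro y z h
    exact le_antisymm
      (le_of_tendsto_of_tendsto' (hlim _) (((hlim y).comp h2).const_add 1 |>.sub (hlim z))
        fun n => hs.le_wimp_iterate c y z n)
      (le_of_tendsto_of_tendsto' (((hlim y).const_add 1).sub (hlim z)) (hlim _)
        fun n => hs.wimp_iterate_le c y z n h)

/-- The kernel of a Bosbach state. -/
def ker : PseudoBCKFilter A where
  carrier := {x | s x = 1}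
  one_mem := hs.map_one
  mp a b (ha : s a = 1) (hab : s (a ⇀ b) = 1) := by
    have := hs.imp_eq a b
    exact le_antisymm (hs.le_one b) (by linarith [hs.le_one (b ⇀ a)])

theorem mem_ker {x : A} : x ∈ hs.ker.carrier ↔ s x = 1 := Iff.rfl

theorem ker_isNormal : hs.ker.IsNormal := fun a b => by
  rw [hs.mem_ker, hs.mem_ker, hs.imp_eq_wimp]

theorem ker_isProper : hs.ker.IsProper := fun h => by
  have h0 : (0 : A) ∈ hs.ker.carrier := h ▸ Set.mem_univ _
  rw [hs.mem_ker, hs.map_zero] at h0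
  exact zero_ne_one h0

end IsBosbachState

/-! ### Faithful and extreme states -/

namespace IsBosbachState

variable {B : Type*} [BoundedPseudoBCKAlgebra B] {s : B → ℝ} (hs : IsBosbachState s)
  (hf : ∀ x, s x = 1 → x = 1)

include hs hf

theorem eq_of_le_of_faithful {x y : B} (h : x ≤ y) (he : s x = s y) : x = y :=
  le_antisymm h (imp_eq_one.1 (hf _ (by rw [hs.imp_of_le h, he]; ring)))

/-- One inequality always holds, and additivity applied twice gives both sides the same value. -/
theorem isPseudoMV_of_faithful : IsPseudoMV B where
  imp_wimp {y v} h := (hs.eq_of_le_of_faithful hf (le_imp_wimp v y) (by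
    rw [hs.wimp_of_le (le_imp v y), hs.imp_of_le h]; ring)).symm
  wimp_imp {y v} h := (hs.eq_of_le_of_faithful hf (le_wimp_imp v y) (by
    rw [hs.imp_of_le (le_wimp v y), hs.wimp_of_le h]; ring)).symm

theorem total_of_extreme (he : s ∈ Set.extremePoints ℝ {s : B → ℝ | IsBosbachState s})
    (x y : B) : x ≤ y ∨ y ≤ x := by
  have hP := hs.isPseudoMV_of_faithful hf
  by_cases hc : s (x ⇀ y) = 1
  · exact Or.inl (imp_eq_one.1 (hf _ hc))
  right
  set c := x ⇀ y
  have hc' : s c < 1 := lt_of_le_of_ne (hs.le_one _) hc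
  obtain ⟨σ, hsσ, hσ1, hmono, hσc, hfix, h₁, h₂⟩ := hs.exists_iterate_limit c
  have hB := hP.bosbach_of_additive h₁ h₂
  have hσ11 : σ 1 = 1 := le_antisymm (hσ1 1) (hs.map_one ▸ hsσ 1)
  -- If `σ 0 = 1` then `σ` is constantly `1`, while prelinearity makes `y ⇀ x` a fixed point of `c ⇀
  -- ·`, where `σ` agrees with `s`.
  suffices h0 : σ 0 = 1 by
    refine imp_eq_one.1 (hf _ ?_)
    rw [← hfix _ (hP.prelinear x y)]
    exact le_antisymm (hσ1 _) (h0 ▸ hmono (zero_le' _))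
  by_contra h0
  have h0lt : σ 0 < 1 := lt_of_le_of_ne (hσ1 0) h0
  have h0pos : 0 < σ 0 := by
    have h := h₁ 0 c (zero_le' c)
    have h' := hs.imp_of_le (zero_le' c)
    rw [hs.map_zero] at h'
    linarith [hsσ (c ⇀ 0)]
  have hl : 0 < 1 - σ 0 := by linarith
  -- The normalization of `σ` that vanishes at `0`; it takes the value `1` at `c`.
  have hp : IsBosbachState fun z => 1 - (1 - σ z) / (1 - σ 0) := by
    refine ⟨fun z => ⟨?_, ?_⟩, fun u v => ?_, fun u v => ?_, ?_, ?_⟩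
    · rw [sub_nonneg, div_le_one hl]; linarith [hmono (zero_le' z)]
    · have : 0 ≤ (1 - σ z) / (1 - σ 0) := div_nonneg (by linarith [hσ1 z]) hl.le
      linarith
    · field_simp; linarith [(hB u v).1]
    · field_simp; linarith [(hB u v).2]
    · simp [div_self hl.ne']
    · simp [hσ11]
  -- The complementary state, chosen so that weights `1 - σ 0` and `σ 0` recover `s`. It is
  -- nonnegative because `s ≤ σ` at `z ⇀ 0`.
  have hr : IsBosbachState fun z => 1 - (σ z - s z) / σ 0 := by
    refine ⟨fun z => ⟨?_, ?_⟩, fun u v => ?_, fun u v => ?_, ?_, ?_⟩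
    · rw [sub_nonneg, div_le_one h0pos]
      have h := h₁ 0 z (zero_le' z)
      have h' := hs.imp_of_le (zero_le' z)
      rw [hs.map_zero] at h'
      linarith [hsσ (z ⇀ 0)]
    · have : 0 ≤ (σ z - s z) / σ 0 := div_nonneg (by linarith [hsσ z]) h0pos.le
      linarith
    · field_simp; linarith [(hB u v).1, hs.imp_eq u v]
    · field_simp; linarith [(hB u v).2, hs.wimp_eq u v]
    · simp [hs.map_zero, div_self h0pos.ne']
    · simp [hσ11, hs.map_one]
  have := he.2 hp hr ⟨1 - σ 0, σ 0, hl, h0pos, by ring, by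
    funext z
    simp only [Pi.add_apply, Pi.smul_apply, smul_eq_mul]
    field_simp
    ring⟩
  have hcc := congrFun this c
  simp only [hσc, sub_self, zero_div, sub_zero] at hcc
  exact hc hcc.symm

theorem comm_of_extreme (he : s ∈ Set.extremePoints ℝ {s : B → ℝ | IsBosbachState s}) :
    (∀ x y : B, x ⇀ y = x ⇝ y) ∧ ∀ x y : B, (x ⇀ y) ⇀ y = (y ⇀ x) ⇀ x := by
  have hinj : ∀ x y : B, s x = s y → x = y := fun x y h => by
    rcases hs.total_of_extreme hf he x y with hxy | hxy
    · exact hs.eq_of_le_of_faithful hf hxy h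
    · exact (hs.eq_of_le_of_faithful hf hxy h.symm).symm
  have hiw : ∀ x y : B, x ⇀ y = x ⇝ y := fun x y => hinj _ _ (hs.imp_eq_wimp x y)
  refine ⟨hiw, fun x y => ?_⟩
  rw [hiw (x ⇀ y), hiw (y ⇀ x)]
  exact (hs.isPseudoMV_of_faithful hf).join_comm x y

end IsBosbachState

/-! ### MV-algebras as bounded commutative BCK-algebras -/

theorem isTermEquivalentToMVAlgebra_iff (B : Type*) [BoundedPseudoBCKAlgebra B] :
    IsTermEquivalentToMVAlgebra B ↔
      (∀ x y : B, x ⇀ y = x ⇝ y) ∧ ∀ x y : B, (x ⇀ y) ⇀ y = (y ⇀ x) ⇀ x := by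
  constructor
  · rintro ⟨M, -, -, hi, hw, -, -, -⟩
    refine ⟨fun x y => (hi x y).trans (hw x y).symm, fun x y => ?_⟩
    rw [hi x y, hi y x, hi, hi, M.oplus_comm _ y, M.oplus_comm _ x, M.oplus_comm _ y,
      M.oplus_comm _ x]
    exact M.lukasiewicz x y
  · rintro ⟨hw, hc⟩
    -- Double negation is the commutativity law at `y = 0`.
    have hn : ∀ x : B, (x ⇀ 0) ⇀ 0 = x := fun x => by
      rw [hc, imp_eq_one.2 (zero_le' x), one_imp]
    have hex : ∀ x y z : B, x ⇀ (y ⇀ z) = y ⇀ (x ⇀ z) := fun x y z => by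
      rw [hw y z, imp_wimp_comm, ← hw y]
    have hcontra : ∀ x y : B, (x ⇀ 0) ⇀ y = (y ⇀ 0) ⇀ x := fun x y => by
      conv_lhs => rw [← hn y]
      rw [hex, hn]
    have hcontra' : ∀ x y : B, (y ⇀ 0) ⇀ (x ⇀ 0) = x ⇀ y := fun x y => by
      rw [hcontra, hn]
    refine ⟨{ oplus := fun x y => (x ⇀ 0) ⇀ y
              odot := fun x y => (x ⇀ (y ⇀ 0)) ⇀ 0
              neg := fun x => x ⇀ 0
              zero := 0
              one := 1
              oplus_comm := hcontra
              oplus_assoc := fun x y z => ?_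
              neg_zero := imp_self 0
              oplus_zero := hn
              oplus_one := fun x => imp_eq_one.2 (le_one' _)
              neg_neg := hn
              lukasiewicz := fun x y => ?_
              odot_def := fun x y => ?_ }, rfl, rfl, fun x y => ?_, fun x y => ?_,
      fun _ => rfl, fun _ _ => rfl, fun _ _ => rfl⟩
    · rw [hcontra _ z, hex, hcontra z y]
    · rw [hcontra', hcontra', hcontra', hcontra']
      exact hc x y
    · rw [hn]
    · change _ = ((x ⇀ 0) ⇀ 0) ⇀ y
      rw [hn]
    · change _ = ((x ⇀ 0) ⇀ 0) ⇀ y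
      rw [hn, hw]

/-! ### States on simple algebras by counting iterates -/

section Count

variable {B : Type*} [BoundedPseudoBCKAlgebra B]

/-- The least number of times that one has to apply `x ⇀ ·` to `y` to obtain `1`. -/
noncomputable def impCount (x y : B) : ℕ := sInf {n | (x ⇀ ·)^[n] y = 1}

theorem impCount_le_iff {x y : B} (h : ∃ n, (x ⇀ ·)^[n] y = 1) {n : ℕ} :
    impCount x y ≤ n ↔ (x ⇀ ·)^[n] y = 1 := by
  refine ⟨fun hn => ?_, fun hn => Nat.sInf_le hn⟩
  have h1 : (x ⇀ ·)^[impCount x y] y = 1 := Nat.sInf_mem (s := {n | (x ⇀ ·)^[n] y = 1}) h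
  exact one_le_iff.1 (h1 ▸ imp_iterate_monotone_nat x y hn)

/-- Pointwise limits along a nonprincipal ultrafilter exist by compactness of `[0, 1]`, and the
additivity error vanishes. -/
theorem exists_bosbach_of_approx (hw : ∀ x y : B, x ⇀ y = x ⇝ y) (hP : IsPseudoMV B)
    (happ : ∀ K : ℕ, ∃ f : B → ℝ, (∀ x, f x ∈ Set.Icc (0 : ℝ) 1) ∧ f 0 = 0 ∧ f 1 = 1 ∧
      ∀ y z, y ≤ z → |f (z ⇀ y) - (1 + f y - f z)| ≤ 1 / (K + 1)) :
    ∃ s : B → ℝ, IsBosbachState s := by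
  choose f hI h0 h1 hadd using happ
  have hl : ∀ x, ∃ l ∈ Set.Icc (0 : ℝ) 1,
      Filter.Tendsto (fun K => f K x) (Filter.hyperfilter ℕ : Filter ℕ) (nhds l) := fun x =>
    isCompact_Icc.ultrafilter_le_nhds ((Filter.hyperfilter ℕ).map fun K => f K x)
      (Filter.le_principal_iff.2 (Filter.mem_map.2 (Filter.univ_mem' fun K => hI K x)))
  choose s hsI hs using hl
  have hadd' : ∀ y z, y ≤ z → s (z ⇀ y) = 1 + s y - s z := fun y z h => by
    have ht : Filter.Tendsto (fun K => f K (z ⇀ y) - (1 + f K y - f K z))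
        (Filter.hyperfilter ℕ : Filter ℕ) (nhds (s (z ⇀ y) - (1 + s y - s z))) :=
      (hs _).sub (((hs y).const_add 1).sub (hs z))
    have h0' : Filter.Tendsto (fun K => f K (z ⇀ y) - (1 + f K y - f K z))
        (Filter.hyperfilter ℕ : Filter ℕ) (nhds 0) :=
      squeeze_zero_norm (fun K => hadd K y z h)
        (tendsto_one_div_add_atTop_nhds_zero_nat.mono_left Nat.hyperfilter_le_atTop)
    linarith [tendsto_nhds_unique ht h0']
  have hB := hP.bosbach_of_additive hadd' (by simpa only [← hw] using hadd')
  refine ⟨s, hsI, fun x y => (hB x y).1, fun x y => (hB x y).2, ?_, ?_⟩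
  · exact tendsto_nhds_unique (hs 0) (by simp [h0])
  · exact tendsto_nhds_unique (hs 1) (by simp [h1])

/-- In residuated terms the hypothesis gives `z ≤ x ^ j`: divisibility extracts a factor `x` from
`z`, then from `x ⇀ z`, and so on. -/
theorem iterate_imp_le_imp (hP : IsPseudoMV B) (x : B) (j : ℕ) (z u : B)
    (h : ∀ i < j, (x ⇀ ·)^[i] z ≤ x) : (x ⇀ ·)^[j] u ≤ z ⇀ u := by
  induction j generalizing z u with
  | zero => exact le_imp z u
  | succ j ih =>
    rw [Function.iterate_succ_apply, ← hP.imp_imp_imp (z := z) (h 0 (Nat.succ_pos j)) u]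
    refine ih _ _ fun i hi => ?_
    rw [← Function.iterate_succ_apply (x ⇀ ·)]
    exact h (i + 1) (by omega)

variable (hw : ∀ x y : B, x ⇀ y = x ⇝ y) (hP : IsPseudoMV B)
  (hsimple : ∀ x y : B, x ≠ 1 → ∃ n, (x ⇀ ·)^[n] y = 1)

include hP hsimple in
-- By prelinearity `y ⇀ x` is fixed by `(x ⇀ y) ⇀ ·`, so iteration cannot bring it to `1` unless it
-- is already there.
theorem total_of_simple (x y : B) : x ≤ y ∨ y ≤ x := by
  by_contra! h
  obtain ⟨n, hn⟩ := hsimple (x ⇀ y) (y ⇀ x) (fun h1 => h.1 (imp_eq_one.1 h1))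
  rw [Function.iterate_fixed (hP.prelinear x y)] at hn
  exact h.2 (imp_eq_one.1 hn)

include hw hsimple in
theorem impCount_le_add {x : B} (hx : x ≠ 1) (y z : B) :
    impCount x y ≤ impCount x z + impCount x (z ⇀ y) := by
  have hz := (impCount_le_iff (hsimple x z hx)).1 le_rfl
  have he := (impCount_le_iff (hsimple x (z ⇀ y) hx)).1 le_rfl
  rw [impCount_le_iff (hsimple x y hx), Function.iterate_add_apply, ← one_le_iff, ← hz]
  rw [hw z y, imp_iterate_wimp, wimp_eq_one, ← hw] at he
  exact (imp_mono x).iterate _ he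

include hP hsimple in
-- Converse of `impCount_le_add` up to a defect `e`, the number of final iterates of `z` not
-- required to lie below `x`.
theorem impCount_add_le {x : B} (hx : x ≠ 1) {y z : B} (hyz : y ≤ z) (e : ℕ)
    (h : ∀ i < impCount x z - e, (x ⇀ ·)^[i] z ≤ x) :
    impCount x z + impCount x (z ⇀ y) ≤ impCount x y + e := by
  have hy := (impCount_le_iff (hsimple x y hx)).1 le_rfl
  have hzy : impCount x z ≤ impCount x y := by
    rw [impCount_le_iff (hsimple x z hx), ← one_le_iff, ← hy]
    exact (imp_mono x).iterate _ hyz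
  have : impCount x (z ⇀ y) ≤ impCount x y - (impCount x z - e) := by
    rw [impCount_le_iff (hsimple x _ hx), ← one_le_iff, ← hy]
    have hsplit : impCount x y = (impCount x y - (impCount x z - e)) + (impCount x z - e) := by
      omega
    conv_lhs => rw [hsplit, Function.iterate_add_apply]
    exact (imp_mono x).iterate _ (iterate_imp_le_imp hP x _ z y h)
  omega

include hsimple in
theorem impCount_le_zero {x : B} (hx : x ≠ 1) (y : B) : impCount x y ≤ impCount x 0 := by
  rw [impCount_le_iff (hsimple x y hx), ← one_le_iff,
    ← (impCount_le_iff (hsimple x 0 hx)).1 le_rfl]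
  exact (imp_mono x).iterate _ (zero_le' y)

include hsimple in
theorem impCount_zero_pos (h01 : (0 : B) ≠ 1) {x : B} (hx : x ≠ 1) : 0 < impCount x 0 := by
  by_contra! h
  exact h01 ((impCount_le_iff (hsimple x 0 hx)).1 h)

include hw hP hsimple in
theorem exists_approx_of_impCount (h01 : (0 : B) ≠ 1) {x : B} (hx : x ≠ 1) (e K : ℕ)
    (hK : e * (K + 1) ≤ impCount x 0)
    (h : ∀ z, ∀ i < impCount x z - e, (x ⇀ ·)^[i] z ≤ x) :
    ∃ f : B → ℝ, (∀ x, f x ∈ Set.Icc (0 : ℝ) 1) ∧ f 0 = 0 ∧ f 1 = 1 ∧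
      ∀ y z, y ≤ z → |f (z ⇀ y) - (1 + f y - f z)| ≤ 1 / (K + 1) := by
  have hN : (0 : ℝ) < impCount x 0 := by exact_mod_cast impCount_zero_pos hsimple h01 hx
  have hK' : (e : ℝ) * (K + 1) ≤ impCount x 0 := by exact_mod_cast hK
  refine ⟨fun y => 1 - impCount x y / impCount x 0, fun y => ⟨?_, ?_⟩, ?_, ?_, fun y z hyz => ?_⟩
  · rw [sub_nonneg, div_le_one hN]
    exact_mod_cast impCount_le_zero hsimple hx y
  · have : (0 : ℝ) ≤ impCount x y / impCount x 0 := by positivity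
    linarith
  · simp [div_self hN.ne']
  · have : impCount x (1 : B) = 0 :=
      Nat.le_zero.1 ((impCount_le_iff (hsimple x 1 hx)).2 rfl)
    simp [this]
  · have h₁ : (impCount x y : ℝ) ≤ impCount x z + impCount x (z ⇀ y) := by
      exact_mod_cast impCount_le_add hw hsimple hx y z
    have h₂ : (impCount x z : ℝ) + impCount x (z ⇀ y) ≤ impCount x y + e := by
      exact_mod_cast impCount_add_le hP hsimple hx hyz e (h z)
    have heq : 1 - (impCount x (z ⇀ y) : ℝ) / impCount x 0 -
        (1 + (1 - (impCount x y : ℝ) / impCount x 0) - (1 - (impCount x z : ℝ) / impCount x 0)) =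
        (impCount x y - impCount x z - impCount x (z ⇀ y)) / impCount x 0 := by
      field_simp
      ring
    rw [heq, abs_div, abs_of_pos hN, div_le_div_iff₀ hN (by positivity), one_mul]
    refine le_trans (mul_le_mul_of_nonneg_right ?_ (by positivity)) hK'
    rw [abs_le]
    constructor <;> linarith

include hsimple in
-- Without coatoms the count of `0` can always be raised: take `t` strictly between `1` and the last
-- iterate of `0` under `x ⇀ ·` before `1`. If `t` needed no more steps than `x`, it would lie below
-- that iterate.
theorem exists_impCount_ge (h01 : (0 : B) ≠ 1)
    (hco : ∀ p : B, p ≠ 1 → ∃ t, p ≤ t ∧ t ≠ p ∧ t ≠ 1) (K : ℕ) :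
    ∃ x : B, x ≠ 1 ∧ K ≤ impCount x 0 := by
  induction K with
  | zero => exact ⟨0, h01, Nat.zero_le _⟩
  | succ K ih =>
    obtain ⟨x, hx, hK⟩ := ih
    obtain ⟨N, hN⟩ : ∃ N, impCount x 0 = N + 1 :=
      Nat.exists_eq_succ_of_ne_zero (impCount_zero_pos hsimple h01 hx).ne'
    have hp : (x ⇀ ·)^[N] 0 ≠ 1 := fun h => by
      have := (impCount_le_iff (hsimple x 0 hx)).2 h
      omega
    have hxp : x ≤ (x ⇀ ·)^[N] 0 := by
      rw [← imp_eq_one]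
      have := (impCount_le_iff (hsimple x 0 hx)).1 hN.le
      rwa [Function.iterate_succ_apply'] at this
    obtain ⟨t, hpt, htp, ht⟩ := hco _ hp
    refine ⟨t, ht, ?_⟩
    by_contra! hlt
    have h1 := (impCount_le_iff (hsimple t 0 ht)).1 (show impCount t 0 ≤ N + 1 by omega)
    rw [Function.iterate_succ_apply', imp_eq_one] at h1
    exact htp (le_antisymm (h1.trans (imp_iterate_anti (hxp.trans hpt) 0 N)) hpt)

include hw hP hsimple in
theorem exists_bosbach_of_simple (h01 : (0 : B) ≠ 1) : ∃ s : B → ℝ, IsBosbachState s := by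
  refine exists_bosbach_of_approx hw hP fun K => ?_
  by_cases hco : ∀ p : B, p ≠ 1 → ∃ t, p ≤ t ∧ t ≠ p ∧ t ≠ 1
  · obtain ⟨x, hx, hK⟩ := exists_impCount_ge hsimple h01 hco (K + 1)
    -- Defect `1`: an iterate above `x` is sent to `1` by the next step, so only the last iterate
    -- before `1` can fail to lie below `x`.
    refine exists_approx_of_impCount hw hP hsimple h01 hx 1 K (by omega) fun z i hi => ?_
    refine (total_of_simple hP hsimple _ _).resolve_right fun hle => ?_
    rw [← imp_eq_one, ← Function.iterate_succ_apply' (x ⇀ ·),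
      ← impCount_le_iff (hsimple x z hx)] at hle
    omega
  · push Not at hco
    obtain ⟨x, hx, hco⟩ := hco
    -- Here `x` is a coatom: an iterate above `x` is `x` or `1`, so there is no defect.
    refine exists_approx_of_impCount hw hP hsimple h01 hx 0 K (by omega) fun z i hi => ?_
    rcases total_of_simple hP hsimple ((x ⇀ ·)^[i] z) x with hle | hle
    · exact hle
    · by_contra hne
      have h1 := hco _ hle fun h => hne h.le
      rw [← impCount_le_iff (hsimple x z hx)] at h1
      omega

end Count

theorem IsPseudoMV.of_comm {B : Type*} [BoundedPseudoBCKAlgebra B]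
    (hw : ∀ x y : B, x ⇀ y = x ⇝ y) (hc : ∀ x y : B, (x ⇀ y) ⇀ y = (y ⇀ x) ⇀ x) :
    IsPseudoMV B where
  imp_wimp {y v} h := by rw [← hw, hc, imp_eq_one.2 h, one_imp]
  wimp_imp {y v} h := by rw [← hw, hc, imp_eq_one.2 h, one_imp]

/-! ### Maximal filters and their quotients -/

namespace PseudoBCKFilter

theorem isProper_iff {A : Type*} [BoundedPseudoBCKAlgebra A] (F : PseudoBCKFilter A) :
    F.IsProper ↔ (0 : A) ∉ F.carrier := by
  refine not_congr ⟨fun h => h ▸ Set.mem_univ _, fun h => Set.eq_univ_of_forall fun x => ?_⟩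
  exact F.mem_of_le (zero_le' x) h

namespace Quotient

variable {A : Type*} [BoundedPseudoBCKAlgebra A] {F : PseudoBCKFilter A}

theorem isTermEquivalentToMVAlgebra_iff (hF : F.IsNormal) :
    IsTermEquivalentToMVAlgebra (F.Quotient hF) ↔
      (∀ a b : A, (a ⇀ b) ⇀ (a ⇝ b) ∈ F.carrier ∧ (a ⇝ b) ⇀ (a ⇀ b) ∈ F.carrier) ∧
      ∀ a b : A, ((a ⇀ b) ⇀ b) ⇀ ((b ⇀ a) ⇀ a) ∈ F.carrier ∧
        ((b ⇀ a) ⇀ a) ⇀ ((a ⇀ b) ⇀ b) ∈ F.carrier := by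
  rw [_root_.isTermEquivalentToMVAlgebra_iff]
  refine and_congr ⟨fun h a b => (mk_eq_mk hF _ _).1 (h (mk hF a) (mk hF b)), fun h => ?_⟩
    ⟨fun h a b => (mk_eq_mk hF _ _).1 (h (mk hF a) (mk hF b)), fun h => ?_⟩
  · exact ind fun a => ind fun b => (mk_eq_mk hF _ _).2 (h a b)
  · exact ind fun a => ind fun b => (mk_eq_mk hF _ _).2 (h a b)

theorem simple_of_isMaximal (hF : F.IsNormal) (hmax : F.IsMaximal)
    (hw : ∀ x y : F.Quotient hF, x ⇀ y = x ⇝ y) (x y : F.Quotient hF) (hx : x ≠ 1) :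
    ∃ n, (x ⇀ ·)^[n] y = 1 := by
  -- The preimage in `A` of the filter generated by `x`. It contains `F` strictly, so by maximality
  -- it is all of `A`.
  let G : PseudoBCKFilter A :=
    { carrier := {a | ∃ n, (x ⇀ ·)^[n] (mk hF a) = 1}
      one_mem := ⟨0, rfl⟩
      mp := by
        rintro a b ⟨n, hn⟩ ⟨m, hm⟩
        refine ⟨n + m, ?_⟩
        change (x ⇀ ·)^[m] (mk hF a ⇀ mk hF b) = 1 at hm
        rw [hw (mk hF a), imp_iterate_wimp, wimp_eq_one] at hm
        rw [Function.iterate_add_apply, ← one_le_iff, ← hn]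
        exact (imp_mono x).iterate n hm }
  have hFG : F.carrier ⊆ G.carrier := fun a ha => ⟨0, (mk_eq_one hF a).2 ha⟩
  have hG : ¬ G.IsProper := fun hG => by
    have heq := hmax.2 G hG hFG
    induction x using ind with
    | h a =>
      have ha : a ∈ G.carrier := ⟨1, imp_self _⟩
      rw [heq] at ha
      exact hx ((mk_eq_one hF a).2 ha)
  induction y using ind with
  | h b =>
    have hb : b ∈ G.carrier := (not_not.1 hG : G.carrier = Set.univ) ▸ Set.mem_univ b
    exact hb

theorem bosbach_comp_mk (hF : F.IsNormal) {s : F.Quotient hF → ℝ} (hs : IsBosbachState s) :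
    IsBosbachState fun a => s (mk hF a) :=
  ⟨fun _ => hs.mem_Icc _, fun a b => hs.imp_eq (mk hF a) (mk hF b),
    fun a b => hs.wimp_eq (mk hF a) (mk hF b),
    hs.map_zero, hs.map_one⟩

end Quotient

variable {A : Type*} [BoundedPseudoBCKAlgebra A]

theorem exists_bosbach_of_isMaximal {F : PseudoBCKFilter A} (hF : F.IsNormal)
    (hmax : F.IsMaximal) (hMV : IsTermEquivalentToMVAlgebra (F.Quotient hF)) :
    ∃ s : A → ℝ, IsBosbachState s := by
  obtain ⟨hw, hc⟩ := (_root_.isTermEquivalentToMVAlgebra_iff _).1 hMV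
  have h01 : (0 : F.Quotient hF) ≠ 1 := fun h =>
    (isProper_iff F).1 hmax.1 ((Quotient.mk_eq_one hF 0).1 h)
  obtain ⟨s, hs⟩ := exists_bosbach_of_simple hw (IsPseudoMV.of_comm hw hc)
    (Quotient.simple_of_isMaximal hF hmax hw) h01
  exact ⟨_, Quotient.bosbach_comp_mk hF hs⟩

theorem exists_isMaximal_ge (F : PseudoBCKFilter A) (hF : F.IsProper) :
    ∃ G : PseudoBCKFilter A, G.IsMaximal ∧ F.carrier ⊆ G.carrier := by
  obtain ⟨M, hFM, hM⟩ := zorn_subset_nonempty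
    {S : Set A | ∃ G : PseudoBCKFilter A, G.carrier = S ∧ G.IsProper} (fun C hC hchain hne => by
      obtain ⟨S₀, hS₀⟩ := hne
      refine ⟨⋃₀ C, ⟨⟨⋃₀ C, ?_, ?_⟩, rfl, ?_⟩, fun S hS => Set.subset_sUnion_of_mem hS⟩
      · obtain ⟨G, rfl, -⟩ := hC hS₀
        exact ⟨_, hS₀, G.one_mem⟩
      · rintro a b ⟨S, hS, ha⟩ ⟨T, hT, hab⟩
        obtain ⟨U, hU, hSU, hTU⟩ := hchain.directedOn S hS T hT
        obtain ⟨G, rfl, -⟩ := hC hU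
        exact ⟨_, hU, G.mp a b (hSU ha) (hTU hab)⟩
      · rw [isProper_iff]
        rintro ⟨S, hS, h0⟩
        obtain ⟨G, rfl, hG⟩ := hC hS
        exact (isProper_iff G).1 hG h0) F.carrier ⟨F, rfl, hF⟩
  obtain ⟨G, rfl, hG⟩ := hM.prop
  exact ⟨G, ⟨hG, fun H hH hGH => (hM.eq_of_subset ⟨H, rfl, hH⟩ hGH).symm⟩, hFM⟩

theorem exists_isMaximal_of_isProper {F : PseudoBCKFilter A} (hF : F.IsNormal) (hp : F.IsProper)
    (hMV : IsTermEquivalentToMVAlgebra (F.Quotient hF)) :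
    ∃ (G : PseudoBCKFilter A) (hG : G.IsNormal),
      G.IsMaximal ∧ IsTermEquivalentToMVAlgebra (G.Quotient hG) := by
  obtain ⟨G, hmax, hFG⟩ := F.exists_isMaximal_ge hp
  obtain ⟨hw, hc⟩ := (Quotient.isTermEquivalentToMVAlgebra_iff hF).1 hMV
  -- Normality survives the enlargement because `⇀` and `⇝` already agree modulo `F`.
  have hG : G.IsNormal := fun a b =>
    ⟨fun h => G.mp _ _ h (hFG (hw a b).1), fun h => G.mp _ _ h (hFG (hw a b).2)⟩
  exact ⟨G, hG, hmax, (Quotient.isTermEquivalentToMVAlgebra_iff hG).2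
    ⟨fun a b => (hw a b).imp (@hFG _) (@hFG _), fun a b => (hc a b).imp (@hFG _) (@hFG _)⟩⟩

end PseudoBCKFilter

/-! ### Extreme states and the main equivalence -/

theorem isCompact_setOf_isBosbachState (A : Type*) [BoundedPseudoBCKAlgebra A] :
    IsCompact {s : A → ℝ | IsBosbachState s} := by
  refine (isCompact_univ_pi fun _ : A => isCompact_Icc (a := (0 : ℝ)) (b := 1)).of_isClosed_subset
    ?_ fun s hs x _ => hs.mem_Icc x
  have heq : {s : A → ℝ | IsBosbachState s} =
      {s | ∀ x, s x ∈ Set.Icc (0 : ℝ) 1} ∩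
      {s | ∀ x y : A, s x + s (x ⇀ y) = s y + s (y ⇀ x)} ∩
      {s | ∀ x y : A, s x + s (x ⇝ y) = s y + s (y ⇝ x)} ∩ {s | s 0 = 0} ∩ {s | s 1 = 1} := by
    ext s
    exact ⟨fun h => ⟨⟨⟨⟨h.1, h.2⟩, h.3⟩, h.4⟩, h.5⟩,
      fun h => ⟨h.1.1.1.1, h.1.1.1.2, h.1.1.2, h.1.2, h.2⟩⟩
  rw [heq]
  refine ((((IsClosed.inter ?_ ?_).inter ?_).inter ?_).inter ?_)
  · simp only [Set.ofPred_forall]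
    exact isClosed_iInter fun x => isClosed_Icc.preimage (continuous_apply x)
  · simp only [Set.ofPred_forall]
    exact isClosed_iInter fun x => isClosed_iInter fun y =>
      isClosed_eq (by fun_prop) (by fun_prop)
  · simp only [Set.ofPred_forall]
    exact isClosed_iInter fun x => isClosed_iInter fun y =>
      isClosed_eq (by fun_prop) (by fun_prop)
  · exact isClosed_eq (by fun_prop) (by fun_prop)
  · exact isClosed_eq (by fun_prop) (by fun_prop)

theorem IsBosbachState.isTermEquivalentToMVAlgebra_of_extreme {A : Type*}
    [BoundedPseudoBCKAlgebra A] {s : A → ℝ} (hs : IsBosbachState s)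
    (he : s ∈ Set.extremePoints ℝ {s : A → ℝ | IsBosbachState s}) :
    IsTermEquivalentToMVAlgebra (hs.ker.Quotient hs.ker_isNormal) := by
  have hF := hs.ker_isNormal
  have hlift : ∀ a b : A, hs.ker.theta a b → s a = s b := fun a b h => by
    have h₁ := hs.imp_le a b
    have h₂ := hs.imp_le b a
    rw [hs.mem_ker.1 h.1] at h₁
    rw [hs.mem_ker.1 h.2] at h₂
    linarith
  let t : hs.ker.Quotient hF → ℝ := _root_.Quotient.lift s hlift
  have htmk : ∀ a, t (PseudoBCKFilter.Quotient.mk hF a) = s a := fun _ => rfl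
  have ht : IsBosbachState t := by
    refine ⟨PseudoBCKFilter.Quotient.ind hs.mem_Icc,
      PseudoBCKFilter.Quotient.ind fun x => PseudoBCKFilter.Quotient.ind fun y => hs.imp_eq x y,
      PseudoBCKFilter.Quotient.ind fun x => PseudoBCKFilter.Quotient.ind fun y => hs.wimp_eq x y,
      hs.map_zero, hs.map_one⟩
  have hf : ∀ x, t x = 1 → x = 1 :=
    PseudoBCKFilter.Quotient.ind fun a ha => (PseudoBCKFilter.Quotient.mk_eq_one hF a).2 ha
  refine (isTermEquivalentToMVAlgebra_iff _).2 (ht.comm_of_extreme hf ⟨ht, ?_⟩)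
  -- The induced state stays extreme: a decomposition on the quotient pulls back to one of `s`.
  rintro p hp r hr ⟨α, β, hα, hβ, hαβ, hpr⟩
  have := he.2 (PseudoBCKFilter.Quotient.bosbach_comp_mk hF hp)
    (PseudoBCKFilter.Quotient.bosbach_comp_mk hF hr) ⟨α, β, hα, hβ, hαβ, by
      funext a
      exact congrFun hpr (PseudoBCKFilter.Quotient.mk hF a)⟩
  funext x
  induction x using PseudoBCKFilter.Quotient.ind with
  | h a => exact congrFun this a

theorem mainTheorem8 {A : Type*} [BoundedPseudoBCKAlgebra A] :
    List.TFAE [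
      ∃ s : A → ℝ, IsBosbachState s,
      ∃ (F : PseudoBCKFilter A) (hF : F.IsNormal),
        F.IsProper ∧ IsTermEquivalentToMVAlgebra (F.Quotient hF),
      ∃ (F : PseudoBCKFilter A) (hF : F.IsNormal),
        F.IsMaximal ∧ IsTermEquivalentToMVAlgebra (F.Quotient hF)] := by
  tfae_have 1 → 2 := fun ⟨s, hs⟩ => by
    obtain ⟨e, he⟩ := (isCompact_setOf_isBosbachState A).extremePoints_nonempty ⟨s, hs⟩
    have hes : IsBosbachState e := he.1
    exact ⟨hes.ker, hes.ker_isNormal, hes.ker_isProper,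
      hes.isTermEquivalentToMVAlgebra_of_extreme he⟩
  tfae_have 2 → 3 := fun ⟨_, hF, hp, hMV⟩ =>
    PseudoBCKFilter.exists_isMaximal_of_isProper hF hp hMV
  tfae_have 3 → 1 := fun ⟨_, hF, hmax, hMV⟩ =>
    PseudoBCKFilter.exists_bosbach_of_isMaximal hF hmax hMV
  tfae_finish
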